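/- A multi-matrix algebra is a finite direct sum $\mathcal A=\bigoplus_{x\in X}\mathbb M_{m_x}$ of complex matrix algebras, with componentwise operations, adjoint $A^\dagger=\bigoplus_x A_x^\dagger$ and trace $\mathrm{tr}(A)=\sum_x\mathrm{tr}(A_x)$. The tensor product of two such algebras is again one, $\mathcal A\otimes\mathcal B=\bigoplus_{(x,y)}\mathbb M_{m_x}\otimes\mathbb M_{n_y}$. A state $\rho\in\mathcal A$ is an element of trace $1$ all of whose blocks are positive semidefinite. Its von Neumann entropy is $S(\rho)=-\sum_\lambda\lambda\log\lambda$, where $\lambda$ runs over the eigenvalues (with multiplicity) of the block-diagonal matrix representing $\rho$, and $0\log 0=0$. A process $(\rho,\mathcal E)$ from $\mathcal A$ to $\mathcal B$ consists of a state $\rho\in\mathcal A$ and a completely positive trace-preserving linear map $\mathcal E:\mathcal A\to\mathcal B$. Let $\mu_{\mathcal A}:\mathcal A\otimes\mathcal A\to\mathcal A$ be the multiplication map, $\mu_{\mathcal A}^*$ its adjoint for the Hilbert–Schmidt inner products $\langle A,B\rangle=\mathrm{tr}(A^\dagger B)$, and $\mathscr J[\mathcal E]=(\mathrm{id}_{\mathcal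 A}\otimes\mathcal E)(\mu_{\mathcal A}^*(\mathbf 1_{\mathcal A}))\in\mathcal A\otimes\mathcal B$. For $p\in[0,1]$ the $p$-bloom assigns to every process $(\rho,\mathcal E)$ between multi-matrix algebras the element $$\psi_p(\rho,\mathcal E)=(\rho^p\otimes\mathbf 1)\,\mathscr J[\mathcal E]\,(\rho^{1-p}\otimes\mathbf 1)\in\mathcal A\otimes\mathcal B,\qquad \rho^0:=\mathbf 1 .$$ The $(p,q,r)$-family consists of all $r\,\psi_p+(1-r)\,\psi_q$ with $p,q,r\in[0,1]$. **Corollary 5.5.** Let $\psi$ be an element of the $(p,q,r)$-family, let $\mathcal A,\mathcal B$ be multi-matrix algebras, and let $(\rho,\mathcal E)$ be a process from $\mathcal A$ to $\mathcal B$ such that $\mathcal E$ is a $*$-isomorphism. Then $$-\mathrm{tr}\Big(\psi(\rho,\mathcal E)\log\big|\psi(\rho,\mathcal E)\big|\Big)=S(\rho),$$ where $|T|=\sqrt{T^\dagger T}$ and the convention $0\log 0=0$ is used (that is, $\log|T|$ is set to $0$ on $\ker|T|=\ker T$). The same value is obtained from the eigenvalues of $\psi(\rho,\mathcal E)$: $$-\sum_{\lambda}\lambda\log|\lambda|=S(\rho),$$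 where $\lambda$ runs over the eigenvalues of all the blocks of $\psi(\rho,\mathcal E)$, counted with algebraic multiplicity. -/

import Mathlib

universe u v

open scoped ComplexOrder

set_option linter.unusedSectionVars false
set_option linter.checkUnivs false

noncomputable section

/-- The multi-matrix algebra `⨁ x, M_{ι x}(ℂ)`, with blocks indexed by `x : X` and the rows and
columns of the block `x` indexed by `ι x` (for the paper's `M_{m x}` one takes `ι x = Fin (m x)`).
Addition, multiplication, unit and `star` (the adjoint `†`) are the componentwise ones. -/
abbrev MultiMat {X : Type*} (ι : X → Type) : Type _ :=
  (x : X) → Matrix (ι x) (ι x) ℂ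

/-- Index family of `(⨁ x, M_{ι x}) ⊗ (⨁ y, M_{κ y}) = ⨁ (x, y), M_{ι x} ⊗ M_{κ y}`. -/
abbrev tensorIndex {X Y : Type*} (ι : X → Type) (κ : Y → Type) : X × Y → Type :=
  fun z => ι z.1 × κ z.2

namespace MultiMat

variable {X Y Z : Type*} {ι : X → Type} {κ : Y → Type} {θ : Z → Type}

/-- The elementary tensor `A ⊗ B` (blockwise Kronecker product). -/
def tmul (A : MultiMat ι) (B : MultiMat κ) : MultiMat (tensorIndex ι κ) :=
  fun z => Matrix.kroneckerMap (· * ·) (A z.1) (B z.2)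

/-- `id ⊗ E`: apply `E` to the second tensor leg, for each matrix entry of the first leg. -/
def idTensor (ι : X → Type) (E : MultiMat κ →ₗ[ℂ] MultiMat θ) :
    MultiMat (tensorIndex ι κ) →ₗ[ℂ] MultiMat (tensorIndex ι θ) where
  toFun T := fun z => Matrix.of fun a b =>
    E (fun y => Matrix.of fun k l => T (z.1, y) (a.1, k) (b.1, l)) z.2 a.2 b.2
  map_add' S T := by
    funext z
    ext a b
    exact congrFun (congrFun (congrFun (E.map_add
      (fun y => Matrix.of fun k l => S (z.1, y) (a.1, k) (b.1, l))
      (fun y => Matrix.of fun k l => T (z.1, y) (a.1, k) (b.1, l))) z.2) a.2) b.2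
  map_smul' c T := by
    funext z
    ext a b
    exact congrFun (congrFun (congrFun (E.map_smul c
      (fun y => Matrix.of fun k l => T (z.1, y) (a.1, k) (b.1, l))) z.2) a.2) b.2

/-- `id ⊗ E` is characterized by its values on elementary tensors. -/
theorem idTensor_tmul (E : MultiMat κ →ₗ[ℂ] MultiMat θ) (A : MultiMat ι) (B : MultiMat κ) :
    idTensor ι E (tmul A B) = tmul A (E B) := by
  funext z
  ext a b
  exact congrFun (congrFun (congrFun (E.map_smul (A z.1 a.1 b.1) B) z.2) a.2) b.2

/-- `E ⊗ id`: apply `E` to the first tensor leg, for each matrix entry of the second leg. -/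
def tensorId (E : MultiMat ι →ₗ[ℂ] MultiMat κ) (θ : Z → Type) :
    MultiMat (tensorIndex ι θ) →ₗ[ℂ] MultiMat (tensorIndex κ θ) where
  toFun T := fun z => Matrix.of fun a b =>
    E (fun x => Matrix.of fun i j => T (x, z.2) (i, a.2) (j, b.2)) z.1 a.1 b.1
  map_add' S T := by
    funext z
    ext a b
    exact congrFun (congrFun (congrFun (E.map_add
      (fun x => Matrix.of fun i j => S (x, z.2) (i, a.2) (j, b.2))
      (fun x => Matrix.of fun i j => T (x, z.2) (i, a.2) (j, b.2))) z.1) a.1) b.1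
  map_smul' c T := by
    funext z
    ext a b
    exact congrFun (congrFun (congrFun (E.map_smul c
      (fun x => Matrix.of fun i j => T (x, z.2) (i, a.2) (j, b.2))) z.1) a.1) b.1

/-- `E ⊗ id` is characterized by its values on elementary tensors. -/
theorem tensorId_tmul (E : MultiMat ι →ₗ[ℂ] MultiMat κ) (A : MultiMat ι) (C : MultiMat θ) :
    tensorId E θ (tmul A C) = tmul (E A) C := by
  funext z
  ext a b
  have h : (fun x => Matrix.of fun i j => A x i j * C z.2 a.2 b.2 : MultiMat ι)
      = C z.2 a.2 b.2 • A := by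
    funext x
    ext i j
    exact mul_comm _ _
  change E (fun x => Matrix.of fun i j => A x i j * C z.2 a.2 b.2) z.1 a.1 b.1
    = E A z.1 a.1 b.1 * C z.2 a.2 b.2
  rw [h, E.map_smul]
  exact mul_comm _ _

section Finite

variable [Fintype X] [DecidableEq X] [∀ x, Fintype (ι x)] [∀ x, DecidableEq (ι x)]
variable [Fintype Y] [DecidableEq Y] [∀ y, Fintype (κ y)] [∀ y, DecidableEq (κ y)]

/-- The trace `tr A = ∑ x, tr (A x)`. -/
def trace (A : MultiMat ι) : ℂ := ∑ x, (A x).trace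

/-- Positivity: every block is self-adjoint with non-negative spectrum. -/
def IsPositive (A : MultiMat ι) : Prop := ∀ x, (A x).PosSemidef

/-- A state: positive and of unit trace. -/
def IsState (A : MultiMat ι) : Prop := IsPositive A ∧ trace A = 1

/-- The multiplication map `μ : A ⊗ A → A`. -/
def mulMap (ι : X → Type) [∀ x, Fintype (ι x)] :
    MultiMat (tensorIndex ι ι) →ₗ[ℂ] MultiMat ι where
  toFun T := fun x => Matrix.of fun i l => ∑ j, T (x, x) (i, j) (j, l)
  map_add' S T := by
    funext x
    ext i l
    simp [Finset.sum_add_distrib]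
  map_smul' c T := by
    funext x
    ext i l
    simp [Finset.mul_sum]

/-- `μ` is characterized by its values on elementary tensors. -/
theorem mulMap_tmul (A B : MultiMat ι) : mulMap ι (tmul A B) = A * B := by
  funext x
  ext i l
  simp [mulMap, tmul, Matrix.mul_apply]

/-- The matrix unit `E_{ij}` in the block `x`. -/
def unit (x : X) (i j : ι x) : MultiMat ι := Pi.single x (Matrix.single i j 1)

/-- The Hilbert–Schmidt adjoint `E^*`, whose entry at `(x, i, j)` is `tr (E(E_{ij})† B)`. -/
def hsAdjoint (E : MultiMat ι →ₗ[ℂ] MultiMat κ) : MultiMat κ →ₗ[ℂ] MultiMat ι where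
  toFun B := fun x => Matrix.of fun i j => trace (star (E (unit x i j)) * B)
  map_add' B C := by
    funext x
    ext i j
    simp [trace, mul_add, Finset.sum_add_distrib]
  map_smul' c B := by
    funext x
    ext i j
    simp [trace, Finset.mul_sum]

/-- `A` is the sum of its entries times the matrix units. -/
theorem eq_sum_unit (A : MultiMat ι) : A = ∑ x, ∑ i, ∑ j, A x i j • unit x i j := by
  funext x
  ext i j
  simp only [Finset.sum_apply, Matrix.sum_apply, Pi.smul_apply, Matrix.smul_apply, unit]
  rw [Finset.sum_eq_single x]
  · simp [Matrix.single_apply, ite_and]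
  · intro y _ hy
    simp [Pi.single_eq_of_ne hy.symm]
  · simp

/-- The condition that determines the Hilbert–Schmidt adjoint:
`tr (E(A)† B) = tr (A† E^*(B))`. -/
theorem trace_hsAdjoint (E : MultiMat ι →ₗ[ℂ] MultiMat κ) (A : MultiMat ι) (B : MultiMat κ) :
    trace (star (E A) * B) = trace (star A * hsAdjoint E B) := by
  have h1 : trace (star (E A) * B)
      = ∑ x, ∑ i, ∑ j, star (A x i j) * trace (star (E (unit x i j)) * B) := by
    conv_lhs => rw [eq_sum_unit A]
    simp only [map_sum, map_smul, star_sum, star_smul, Finset.sum_mul, smul_mul_assoc]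
    simp only [trace, Finset.sum_apply, Pi.smul_apply, Matrix.trace_sum, Matrix.trace_smul,
      smul_eq_mul, Finset.mul_sum]
    rw [Finset.sum_comm]
    refine Finset.sum_congr rfl fun x _ => ?_
    rw [Finset.sum_comm]
    refine Finset.sum_congr rfl fun i _ => ?_
    rw [Finset.sum_comm]
  rw [h1]
  simp only [trace, Matrix.trace, Matrix.diag_apply, Pi.mul_apply, Matrix.mul_apply, hsAdjoint,
    LinearMap.coe_mk, AddHom.coe_mk, Matrix.of_apply, Pi.star_apply, Matrix.star_apply]
  refine Finset.sum_congr rfl fun x _ => ?_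
  rw [Finset.sum_comm]

/-- The channel state `J[E] = (id ⊗ E)(μ^*(1))`. -/
def channelState (E : MultiMat ι →ₗ[ℂ] MultiMat κ) : MultiMat (tensorIndex ι κ) :=
  idTensor ι E (hsAdjoint (mulMap ι) 1)

/-- Complete positivity: `E ⊗ id_C` is positive for every matrix algebra `C = M_k`. -/
def IsCompletelyPositive (E : MultiMat ι →ₗ[ℂ] MultiMat κ) : Prop :=
  ∀ (k : ℕ) (T : MultiMat (tensorIndex ι fun _ : Unit => Fin k)),
    IsPositive T → IsPositive (tensorId E (fun _ : Unit => Fin k) T)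

/-- `tr ∘ E = tr`. -/
def IsTracePreserving (E : MultiMat ι →ₗ[ℂ] MultiMat κ) : Prop :=
  ∀ A, trace (E A) = trace A

/-- The power `ρ ^ p` of a positive element, by the spectral functional calculus in each block.
Since `0 ^ 0 = 1` and `0 ^ p = 0` for `p ≠ 0` in `ℝ`, one has `ρ ^ 0 = 1` for every `ρ`. -/
def rpow (ρ : MultiMat ι) (p : ℝ) : MultiMat ι :=
  fun x => cfc (fun t : ℝ => t ^ p) (ρ x)

/-- `|A| = √(A† A)`, the positive square root. -/
def abs (A : MultiMat ι) : MultiMat ι :=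
  fun x => cfc Real.sqrt (star (A x) * A x)

/-- The logarithm of a positive element by the spectral functional calculus, with the value `0`
assigned to the eigenvalue `0`. In `A * log |A|` the latter is the convention `0 log 0 = 0`,
because `A` and `|A|` have the same kernel. -/
def log (A : MultiMat ι) : MultiMat ι := fun x => cfc Real.log (A x)

/-- The multi-spectrum: all eigenvalues with their algebraic multiplicities. -/
def mspec (A : MultiMat ι) : Multiset ℂ := ∑ x, (A x).charpoly.roots

/-- The block-diagonal matrix of size `∑ x, m x` that represents `A`. -/
def bloc (A : MultiMat ι) : Matrix (Σ x, ι x) (Σ x, ι x) ℂ := Matrix.blockDiagonal' A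

end Finite

end MultiMat

/-- The entropy `S(A) = - ∑ λ log |λ|` of a self-adjoint matrix, summed over its eigenvalues with
multiplicities. For a density matrix this is the von Neumann entropy. -/
def matrixEntropy {n : Type*} [Fintype n] [DecidableEq n] (A : Matrix n n ℂ)
    (hA : A.IsHermitian) : ℝ :=
  -∑ i, hA.eigenvalues i * Real.log |hA.eigenvalues i|

namespace MultiMat

variable {X : Type*} {ι : X → Type} [Fintype X] [DecidableEq X]
  [∀ x, Fintype (ι x)] [∀ x, DecidableEq (ι x)]

theorem IsState.bloc_isHermitian {ρ : MultiMat ι} (h : IsState ρ) : (bloc ρ).IsHermitian := by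
  unfold bloc Matrix.IsHermitian
  rw [Matrix.blockDiagonal'_conjTranspose]
  congr 1
  funext x
  exact (h.1 x).isHermitian

/-- The von Neumann entropy `S(ρ) = S(bloc ρ)` of a state of a multi-matrix algebra. -/
def entropy (ρ : MultiMat ι) (h : IsState ρ) : ℝ := matrixEntropy (bloc ρ) h.bloc_isHermitian

end MultiMat

/-- A process `(ρ, E)`: a state `ρ` of `A = ⨁ x, M_{m x}` and a CPTP map
`E : A → B = ⨁ y, M_{n y}`. -/
structure QuantumProcess {X Y : Type*} [Fintype X] [DecidableEq X] [Fintype Y] [DecidableEq Y]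
    (m : X → ℕ) (n : Y → ℕ) where
  state : MultiMat fun x => Fin (m x)
  channel : (MultiMat fun x => Fin (m x)) →ₗ[ℂ] (MultiMat fun y => Fin (n y))
  isState : state.IsState
  completelyPositive : MultiMat.IsCompletelyPositive channel
  tracePreserving : MultiMat.IsTracePreserving channel

/-- Assignments that send each process between multi-matrix algebras `A` and `B` to an element of
`A ⊗ B`, for every pair `(A, B)`. -/
def ProcessFunction : Type (max (u + 1) (v + 1)) :=
  ∀ ⦃X : Type u⦄ ⦃Y : Type v⦄ [Fintype X] [DecidableEq X] [Fintype Y] [DecidableEq Y]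
    ⦃m : X → ℕ⦄ ⦃n : Y → ℕ⦄, QuantumProcess m n →
      MultiMat (tensorIndex (fun x => Fin (m x)) fun y => Fin (n y))

/-- The `p`-bloom `(ρ^p ⊗ 1) J[E] (ρ^(1-p) ⊗ 1)`. -/
def pBloom (p : ℝ) : ProcessFunction.{u, v} := fun _ _ _ _ _ _ _ _ P =>
  (P.state.rpow p).tmul 1 * MultiMat.channelState P.channel * (P.state.rpow (1 - p)).tmul 1

/-- The convex combination `r (p-bloom) + (1 - r) (q-bloom)`. -/
def pqrBloom (p q r : ℝ) : ProcessFunction.{u, v} := fun _ _ _ _ _ _ _ _ P =>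
  (r : ℂ) • pBloom p P + ((1 - r : ℝ) : ℂ) • pBloom q P

/-- The `(p,q,r)`-family: all `r (p-bloom) + (1 - r) (q-bloom)` with `p, q, r ∈ [0,1]`. -/
def pqrFamily : Set ProcessFunction.{u, v} :=
  {ψ | ∃ p ∈ Set.Icc (0 : ℝ) 1, ∃ q ∈ Set.Icc (0 : ℝ) 1, ∃ r ∈ Set.Icc (0 : ℝ) 1,
    ψ = pqrBloom p q r}

end

/-! The element `μ^*(1)` is the swap on the diagonal blocks. It is invariant under `U ⊗ U`, and for
a `*`-isomorphism the map `id ⊗ E` is a trace-preserving `*`-homomorphism. Traces of polynomial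
expressions in `T = ψ(ρ, E)` and `T†` can therefore be computed with `ρ` diagonal and `E` the
identity. There `T` is a weighted swap: it couples `(i, j)` only with `(j, i)`, and its weight at
`(i, i)` is the eigenvalue `λ_i` of `ρ`, whatever `p, q, r` are, since `λ^p λ^(1-p) = λ`. Both `T²`
and `T†T` are diagonal, so in the trace of `T g(T²)` or `T g(T†T)` only the fixed points `(i, i)` of
the swap survive, giving `∑ λ_i g(λ_i²)` (`trace_diagBloom_mul_aeval`, `trace_pqrBloom_mul_aeval`).

Interpolating `g(w) = (log |w|) / 2` on the finitely many relevant spectra turns `T g(T†T)` into `T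
log |T|`, the trace of `T g(T²)` into the eigenvalue sum of `z log |z|`, and `∑ λ_i g(λ_i²)` into
`-S(ρ)`. The eigenvalue sum rests on spectral mapping with algebraic multiplicities
(`roots_charpoly_aeval`), since `T` need not be diagonalizable. -/

namespace Matrix

/-! ### Polynomials in a matrix: spectral mapping and functional calculus. -/

open Polynomial Unitary

variable {n : Type*} [Fintype n] [DecidableEq n]

/-- The determinant of a polynomial expression in `A` is the product of the values of the
polynomial at the eigenvalues of `A`. -/
theorem det_aeval_eq_prod_roots_charpoly {K : Type*} [Field K] [IsAlgClosed K]
    (A : Matrix n n K) (g : K[X]) :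
    (aeval A g).det = (A.charpoly.roots.map fun z => g.eval z).prod := by
  have hcard : A.charpoly.roots.card = Fintype.card n := by
    rw [← (IsAlgClosed.splits A.charpoly).natDegree_eq_card_roots, charpoly_natDegree_eq_dim]
  have hlin (μ : K) : (aeval A (X - C μ)).det
      = (A.charpoly.roots.map fun z => (X - C μ).eval z).prod := by
    have h1 : aeval A (X - C μ) = -(scalar n μ - A) := by
      simp [algebraMap_eq_diagonal, Pi.algebraMap_def]
    have h2 : A.charpoly.eval μ = (A.charpoly.roots.map fun z => μ - z).prod := by
      conv_lhs => rw [(IsAlgClosed.splits A.charpoly).eq_prod_roots_of_monic A.charpoly_monic]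
      simp [eval_multiset_prod, Multiset.map_map]
    have h3 : (A.charpoly.roots.map fun z => (X - C μ).eval z)
        = (A.charpoly.roots.map fun z => μ - z).map Neg.neg := by
      simp [Multiset.map_map]
    -- The sign from the determinant of a negative cancels the one from negating all roots, as there
    -- are `card n` of each.
    rw [h1, det_neg, ← eval_charpoly, h2, h3, Multiset.prod_map_neg]
    simp [hcard]
  -- Both sides are multiplicative in `g`, so linear factors and the leading coefficient suffice;
  -- the latter gives its `card n`-th power on each side.
  rw [(IsAlgClosed.splits g).eq_prod_roots]
  induction g.roots using Multiset.induction_on with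
  | empty => simp [algebraMap_eq_diagonal, Pi.algebraMap_def, hcard]
  | cons μ s ih =>
    simp only [Multiset.map_cons, Multiset.prod_cons]
    rw [mul_left_comm, map_mul, det_mul, ih, hlin]
    simp only [eval_mul (p := X - C μ), Multiset.prod_map_mul]

/-- Spectral mapping for polynomials, with algebraic multiplicities. -/
theorem roots_charpoly_aeval {K : Type*} [Field K] [IsAlgClosed K]
    (A : Matrix n n K) (g : K[X]) :
    (aeval A g).charpoly.roots = A.charpoly.roots.map fun z => g.eval z := by
  have h : (aeval A g).charpoly
      = ((A.charpoly.roots.map fun z => g.eval z).map fun a => X - C a).prod := by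
    -- Over an infinite field it is enough to compare values; at `t` the characteristic polynomial
    -- of `g(A)` is the determinant of `(t - g)(A)`.
    refine Polynomial.funext fun t => ?_
    have h1 : scalar n t - aeval A g = aeval A (C t - g) := by
      simp [algebraMap_eq_diagonal, Pi.algebraMap_def]
    rw [eval_charpoly, h1, det_aeval_eq_prod_roots_charpoly]
    simp [eval_multiset_prod, Multiset.map_map]
  rw [h, roots_multiset_prod_X_sub_C]

/-- The trace of a polynomial expression in `A` is the sum of the values of the polynomial at the
eigenvalues of `A`. -/
theorem trace_aeval_eq_sum_roots_charpoly {K : Type*} [Field K] [IsAlgClosed K]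
    (A : Matrix n n K) (g : K[X]) :
    (aeval A g).trace = (A.charpoly.roots.map fun z => g.eval z).sum := by
  rw [trace_eq_sum_roots_charpoly, roots_charpoly_aeval]

theorem aeval_diagonal {K : Type*} [CommRing K] (d : n → K) (g : K[X]) :
    aeval (diagonal d) g = diagonal fun i => g.eval (d i) := by
  have h := aeval_algHom_apply (diagonalAlgHom (n := n) (α := K) K) d g
  rw [diagonalAlgHom_apply] at h
  rw [h, diagonalAlgHom_apply]
  congr 1
  funext i
  simp

/-- A function of a Hermitian matrix is given by any complex polynomial with the same values on
the spectrum. -/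
theorem IsHermitian.cfc_eq_aeval {A : Matrix n n ℂ} (hA : A.IsHermitian) (f : ℝ → ℝ) (g : ℂ[X])
    (h : ∀ i, g.eval (hA.eigenvalues i : ℂ) = f (hA.eigenvalues i)) :
    cfc f A = aeval A g := by
  rw [hA.cfc_eq]
  conv_rhs => rw [hA.spectral_theorem]
  rw [IsHermitian.cfc]
  have h1 := aeval_algHom_apply
    (conjStarAlgAut ℂ (Matrix n n ℂ) hA.eigenvectorUnitary)
    (diagonal (RCLike.ofReal ∘ hA.eigenvalues)) g
  refine Eq.trans ?_ h1.symm
  rw [aeval_diagonal]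
  refine congrArg (conjStarAlgAut ℂ (Matrix n n ℂ) hA.eigenvectorUnitary) ?_
  congr 1
  funext i
  exact (h i).symm

/-- The spectrum is finite, so every function is continuous on it and the composition rule applies
despite the discontinuity of `Real.log` at `0`. -/
theorem IsHermitian.cfc_log_cfc_sqrt {A : Matrix n n ℂ} (hA : A.IsHermitian) :
    cfc Real.log (cfc Real.sqrt A) = cfc (Real.log ∘ Real.sqrt) A := by
  have hfin := finite_real_spectrum (A := A)
  exact (cfc_comp Real.log Real.sqrt A hA ((hfin.image _).continuousOn _)
    (hfin.continuousOn _)).symm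

/-- The trace of `T q(T†T)` for a twisted swap `T`: only the fixed points of the swap
contribute. -/
theorem trace_swap_diagonal_mul_aeval (M : n × n → ℂ) (g : ℂ[X]) (W : Matrix (n × n) (n × n) ℂ)
    (hW : W = diagonal (fun a => (M a.swap) * (M a)) ∨
      W = diagonal (fun a => star (M a.swap) * (M a.swap)))
    (l : n → ℝ) (hl : ∀ i, M (i, i) = l i) :
    ((of fun a b : n × n => if b = a.swap then M a else 0) * aeval W g).trace
      = ∑ i, (X * g.comp (X ^ 2)).eval (l i : ℂ) := by
  -- The two forms of `W` differ only away from the fixed points of the swap, where the trace does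
  -- not look.
  obtain ⟨d, hd, rfl⟩ : ∃ d : n × n → ℂ, (∀ i, d (i, i) = (l i : ℂ) ^ 2) ∧ W = diagonal d := by
    rcases hW with h | h
    · exact ⟨_, fun i => by simp [hl, sq], h⟩
    · exact ⟨_, fun i => by simp [hl, sq], h⟩
  rw [aeval_diagonal]
  simp only [trace, diag_apply, mul_diagonal, of_apply, Fintype.sum_prod_type]
  refine Finset.sum_congr rfl fun i _ => ?_
  rw [Finset.sum_eq_single i]
  · simp [hd, hl]
  · intro j _ hj
    simp [hj]
  · simp

end Matrix

noncomputable section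

namespace MultiMat

open Matrix Polynomial Unitary

variable {X Y Z : Type*} {ι : X → Type} {κ : Y → Type} {θ : Z → Type}
variable [Fintype X] [DecidableEq X] [∀ x, Fintype (ι x)] [∀ x, DecidableEq (ι x)]
variable [Fintype Y] [DecidableEq Y] [∀ y, Fintype (κ y)] [∀ y, DecidableEq (κ y)]
variable [Fintype Z] [DecidableEq Z] [∀ z, Fintype (θ z)] [∀ z, DecidableEq (θ z)]

/-! ### Tensor products and the `*`-homomorphism `id ⊗ E`. -/

theorem tmul_mul_tmul (A A' : MultiMat ι) (B B' : MultiMat κ) :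
    tmul A B * tmul A' B' = tmul (A * A') (B * B') := by
  funext z
  exact (mul_kronecker_mul _ _ _ _).symm

theorem star_tmul (A : MultiMat ι) (B : MultiMat κ) : star (tmul A B) = tmul (star A) (star B) := by
  funext z
  exact conjTranspose_kronecker _ _

theorem tmul_one_one : tmul (1 : MultiMat ι) (1 : MultiMat κ) = 1 := by
  funext z
  exact one_kronecker_one

theorem aeval_apply (A : MultiMat ι) (g : ℂ[X]) (x : X) : aeval A g x = aeval (A x) g := by
  exact (aeval_algHom_apply (Pi.evalAlgHom ℂ (fun x => Matrix (ι x) (ι x) ℂ) x) A g).symm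

/-- The element of the second tensor leg at a matrix entry of the first leg. -/
def slice (T : MultiMat (tensorIndex ι κ)) (x : X) (i j : ι x) : MultiMat κ :=
  fun y => of fun k l => T (x, y) (i, k) (j, l)

theorem slice_mul (S T : MultiMat (tensorIndex ι κ)) (x : X) (i j : ι x) :
    slice (S * T) x i j = ∑ k, slice S x i k * slice T x k j := by
  funext y
  ext a b
  simp [slice, mul_apply, Fintype.sum_prod_type, Matrix.sum_apply]

theorem slice_star (T : MultiMat (tensorIndex ι κ)) (x : X) (i j : ι x) :
    slice (star T) x i j = star (slice T x j i) := rfl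

theorem slice_one (x : X) (i j : ι x) :
    slice (1 : MultiMat (tensorIndex ι κ)) x i j = if i = j then 1 else 0 := by
  funext y
  ext a b
  by_cases h : i = j <;> simp [slice, h, one_apply]

theorem idTensor_apply (E : MultiMat κ →ₗ[ℂ] MultiMat θ) (T : MultiMat (tensorIndex ι κ))
    (x : X) (z : Z) (a b : ι x × θ z) :
    idTensor ι E T (x, z) a b = E (slice T x a.1 b.1) z a.2 b.2 := rfl

/-- The `*`-homomorphism `id ⊗ E`. -/
def idTensorStarAlgHom (ι : X → Type) [∀ x, Fintype (ι x)] [∀ x, DecidableEq (ι x)]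
    (E : MultiMat κ →⋆ₐ[ℂ] MultiMat θ) :
    MultiMat (tensorIndex ι κ) →⋆ₐ[ℂ] MultiMat (tensorIndex ι θ) where
  toAlgHom := AlgHom.ofLinearMap (idTensor ι E.toAlgHom.toLinearMap)
    (by
      funext ⟨x, z⟩
      ext ⟨i, k⟩ ⟨j, l⟩
      rw [idTensor_apply, slice_one]
      by_cases h : i = j <;> simp [h, one_apply])
    (by
      intro S T
      funext ⟨x, z⟩
      ext ⟨i, k⟩ ⟨j, l⟩
      rw [idTensor_apply, slice_mul]
      simp [mul_apply, Fintype.sum_prod_type, Matrix.sum_apply, idTensor_apply])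
  map_star' T := by
    funext ⟨x, z⟩
    ext ⟨i, k⟩ ⟨j, l⟩
    change E (slice (star T) x i j) z k l = star (E (slice T x j i) z l k)
    rw [slice_star, map_star]
    rfl

theorem trace_eq_sum_trace_slice (T : MultiMat (tensorIndex ι κ)) :
    trace T = ∑ x, ∑ i, trace (slice T x i i) := by
  simp only [trace, Matrix.trace, diag_apply, Fintype.sum_prod_type]
  refine Finset.sum_congr rfl fun x _ => ?_
  rw [Finset.sum_comm]
  rfl

theorem trace_idTensor {E : MultiMat κ →ₗ[ℂ] MultiMat θ} (hE : IsTracePreserving E)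
    (T : MultiMat (tensorIndex ι κ)) : trace (idTensor ι E T) = trace T := by
  rw [trace_eq_sum_trace_slice, trace_eq_sum_trace_slice T]
  refine Finset.sum_congr rfl fun x _ => Finset.sum_congr rfl fun i _ => ?_
  exact hE (slice T x i i)

/-! ### The swap and its symmetries. -/

/-- The element `μ^*(1)` is the swap in the diagonal blocks. -/
theorem hsAdjoint_mulMap_one_apply (x : X) (a b : ι x × ι x) :
    hsAdjoint (mulMap ι) 1 (x, x) a b = if b = a.swap then 1 else 0 := by
  obtain ⟨i, k⟩ := a
  obtain ⟨j, l⟩ := b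
  have h (y : X) : (star (mulMap ι (unit (x, x) (i, k) (j, l))) y).trace
      = if y = x then (if (j, l) = (i, k).swap then 1 else 0) else 0 := by
    by_cases hy : y = x
    · subst hy
      simp only [Matrix.trace, diag_apply, Pi.star_apply, star_apply, mulMap, LinearMap.coe_mk,
        AddHom.coe_mk, of_apply, unit, Pi.single_eq_same, single_apply, Prod.mk.injEq,
        Prod.swap_prod_mk, if_true]
      by_cases hc : j = k ∧ l = i
      · obtain ⟨rfl, rfl⟩ := hc
        rw [Finset.sum_eq_single l, Finset.sum_eq_single j]
        · simp
        · intro b _ hb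
          simp [hb.symm]
        · simp
        · intro b _ hb
          simp [hb.symm]
        · simp
      · rw [if_neg hc]
        refine Finset.sum_eq_zero fun c _ => ?_
        rw [Finset.sum_eq_zero, star_zero]
        intro d _
        grind
    · simp [Matrix.trace, mulMap, unit, hy]
  simp only [hsAdjoint, LinearMap.coe_mk, AddHom.coe_mk, of_apply, mul_one, trace, h]
  simp

theorem hsAdjoint_mulMap_one_apply_of_ne {x x' : X} (hx : x ≠ x') :
    hsAdjoint (mulMap ι) 1 (x, x') = 0 := by
  ext a b
  have h (y : X) : mulMap ι (unit (x, x') a b) y = 0 := by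
    have : ((y, y) : X × X) ≠ (x, x') := by
      rintro ⟨⟩
      exact hx rfl
    ext i j
    simp [mulMap, unit, Pi.single_eq_of_ne this]
  simp [hsAdjoint, trace, h]

/-- The swap exchanges the tensor legs; in the blocks `(x, x')` with `x ≠ x'` both sides vanish. -/
theorem hsAdjoint_mulMap_one_mul_tmul (A B : MultiMat ι) :
    hsAdjoint (mulMap ι) 1 * tmul A B = tmul B A * hsAdjoint (mulMap ι) 1 := by
  funext ⟨x, x'⟩
  by_cases hx : x = x'
  · subst hx
    ext ⟨i, k⟩ ⟨j, l⟩
    simp only [Pi.mul_apply, mul_apply, hsAdjoint_mulMap_one_apply]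
    rw [Finset.sum_eq_single (k, i), Finset.sum_eq_single (l, j)]
    · simp [tmul, mul_comm]
    · rintro ⟨c, d⟩ - h
      rw [if_neg, mul_zero]
      simp only [ne_eq, Prod.mk.injEq, Prod.swap_prod_mk] at h ⊢
      tauto
    · simp
    · rintro ⟨c, d⟩ - h
      rw [if_neg, zero_mul]
      exact h
    · simp
  · simp [hsAdjoint_mulMap_one_apply_of_ne hx]

/-! ### Diagonalization of the state. -/

theorem trace_conjStarAlgAut (U : unitary (MultiMat ι)) (A : MultiMat ι) :
    trace (conjStarAlgAut ℂ (MultiMat ι) U A) = trace A := by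
  refine Finset.sum_congr rfl fun x _ => ?_
  rw [conjStarAlgAut_apply]
  change ((U : MultiMat ι) x * A x * (star (U : MultiMat ι)) x).trace = _
  rw [trace_mul_cycle, ← Pi.mul_apply, Unitary.coe_star_mul_self]
  simp

/-- `U ⊗ U`. -/
def unitaryTmul (U : unitary (MultiMat ι)) : unitary (MultiMat (tensorIndex ι ι)) :=
  ⟨tmul U U, by
    rw [Unitary.mem_iff, star_tmul, tmul_mul_tmul, tmul_mul_tmul]
    simp [tmul_one_one]⟩

theorem conjStarAlgAut_unitaryTmul (U : unitary (MultiMat ι)) (A B : MultiMat ι) :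
    conjStarAlgAut ℂ _ (unitaryTmul U) (tmul A B)
      = tmul (conjStarAlgAut ℂ _ U A) (conjStarAlgAut ℂ _ U B) := by
  simp [conjStarAlgAut_apply, unitaryTmul, star_tmul, tmul_mul_tmul]

/-- Since the two legs of `U ⊗ U` are equal, it commutes with the swap and cancels against its
adjoint. -/
theorem conjStarAlgAut_unitaryTmul_hsAdjoint (U : unitary (MultiMat ι)) :
    conjStarAlgAut ℂ _ (unitaryTmul U) (hsAdjoint (mulMap ι) 1) = hsAdjoint (mulMap ι) 1 := by
  rw [conjStarAlgAut_apply]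
  change tmul (U : MultiMat ι) (U : MultiMat ι) * _ * _ = _
  rw [← hsAdjoint_mulMap_one_mul_tmul, mul_assoc]
  change _ * ((unitaryTmul U : MultiMat (tensorIndex ι ι)) * _) = _
  simp

/-- A diagonal element with real entries. -/
def diag (l : (x : X) → ι x → ℝ) : MultiMat ι := fun x => diagonal fun i => (l x i : ℂ)

/-- The unitary whose blocks diagonalize the blocks of a self-adjoint element. -/
def eigenvectorUnitary (ρ : MultiMat ι) (hρ : ∀ x, (ρ x).IsHermitian) : unitary (MultiMat ι) :=
  ⟨fun x => (hρ x).eigenvectorUnitary, by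
    constructor
    · funext x
      exact Unitary.coe_star_mul_self (hρ x).eigenvectorUnitary
    · funext x
      exact Unitary.coe_mul_star_self (hρ x).eigenvectorUnitary⟩

theorem rpow_eq_conjStarAlgAut (ρ : MultiMat ι) (hρ : ∀ x, (ρ x).IsHermitian) (p : ℝ) :
    ρ.rpow p = conjStarAlgAut ℂ _ (eigenvectorUnitary ρ hρ)
      (diag fun x i => (hρ x).eigenvalues i ^ p) := by
  funext x
  exact (hρ x).cfc_eq _

/-! ### The bloom of a diagonal state as a weighted swap. -/

/-- The bloom of a diagonal element along the identity. -/
def diagBloom (l : (x : X) → ι x → ℝ) (p q r : ℝ) : MultiMat (tensorIndex ι ι) :=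
  (r : ℂ) • ((diag fun x i => l x i ^ p).tmul 1 * hsAdjoint (mulMap ι) 1
      * (diag fun x i => l x i ^ (1 - p)).tmul 1)
    + ((1 - r : ℝ) : ℂ) • ((diag fun x i => l x i ^ q).tmul 1 * hsAdjoint (mulMap ι) 1
      * (diag fun x i => l x i ^ (1 - q)).tmul 1)

theorem conjStarAlgAut_diagBloom (ρ : MultiMat ι) (hρ : ∀ x, (ρ x).IsHermitian) (p q r : ℝ) :
    conjStarAlgAut ℂ _ (unitaryTmul (eigenvectorUnitary ρ hρ))
      (diagBloom (fun x => (hρ x).eigenvalues) p q r)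
      = (r : ℂ) • ((ρ.rpow p).tmul 1 * hsAdjoint (mulMap ι) 1 * (ρ.rpow (1 - p)).tmul 1)
        + ((1 - r : ℝ) : ℂ) •
          ((ρ.rpow q).tmul 1 * hsAdjoint (mulMap ι) 1 * (ρ.rpow (1 - q)).tmul 1) := by
  rw [diagBloom, map_add, map_smul, map_smul, map_mul, map_mul, map_mul, map_mul]
  rw [conjStarAlgAut_unitaryTmul_hsAdjoint]
  simp only [rpow_eq_conjStarAlgAut _ hρ]
  congr <;> exact (conjStarAlgAut_unitaryTmul _ _ _).trans (by rw [map_one])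

theorem tmul_diag_one_mul_hsAdjoint_mul_apply (l l' : (x : X) → ι x → ℝ) (x : X)
    (a b : ι x × ι x) :
    ((diag l).tmul 1 * hsAdjoint (mulMap ι) 1 * (diag l').tmul 1 : MultiMat (tensorIndex ι ι)) (x, x) a b
      = if b = a.swap then (l x a.1 * l' x a.2 : ℂ) else 0 := by
  have h (l : (x : X) → ι x → ℝ) : (diag l).tmul (1 : MultiMat ι) (x, x)
      = diagonal fun a : ι x × ι x => (l x a.1 : ℂ) := by
    ext ⟨i, k⟩ ⟨j, m⟩
    simp only [tmul, diag, kroneckerMap_apply, diagonal_apply, Pi.one_apply, one_apply,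
      Prod.mk.injEq]
    grind
  simp only [Pi.mul_apply, h, mul_diagonal, diagonal_mul, hsAdjoint_mulMap_one_apply]
  split_ifs with hb <;> simp [hb]

theorem diagBloom_apply_of_ne (l : (x : X) → ι x → ℝ) (p q r : ℝ) {x x' : X} (hx : x ≠ x') :
    diagBloom l p q r (x, x') = 0 := by
  simp [diagBloom, hsAdjoint_mulMap_one_apply_of_ne hx]

theorem diagBloom_apply (l : (x : X) → ι x → ℝ) (p q r : ℝ) (x : X) :
    diagBloom l p q r (x, x) = of fun a b : ι x × ι x => if b = a.swap then
      ((r * (l x a.1 ^ p * l x a.2 ^ (1 - p)) + (1 - r) * (l x a.1 ^ q * l x a.2 ^ (1 - q)) : ℝ) : ℂ)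
      else 0 := by
  ext a b
  simp only [diagBloom, Pi.add_apply, Pi.smul_apply, Matrix.add_apply, Matrix.smul_apply,
    tmul_diag_one_mul_hsAdjoint_mul_apply, of_apply, smul_eq_mul]
  split_ifs <;> simp

theorem trace_tensorIndex_eq_sum_diagonal (T : MultiMat (tensorIndex ι ι))
    (hT : ∀ x x', x ≠ x' → T (x, x') = 0) : trace T = ∑ x, (T (x, x)).trace := by
  rw [trace, Fintype.sum_prod_type]
  refine Finset.sum_congr rfl fun x _ => Finset.sum_eq_single x (fun y _ hy => ?_) (by simp)
  rw [hT x y hy.symm, Matrix.trace_zero]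

theorem rpow_mul_rpow_one_sub {t p : ℝ} (ht : 0 ≤ t) : t ^ p * t ^ (1 - p) = t := by
  -- The exponents add up to `1 ≠ 0`, which makes the addition rule valid at `t = 0` too.
  rw [← Real.rpow_add' ht (by simp)]
  simp

/-- A weighted swap composed with itself or with its adjoint is diagonal, so
`trace_swap_diagonal_mul_aeval` applies block by block; the weights at `(i, i)` are `r λ_i + (1 - r)
λ_i = λ_i`. -/
theorem trace_diagBloom_mul_aeval (l : (x : X) → ι x → ℝ) (hl : ∀ x i, 0 ≤ l x i) (p q r : ℝ)
    (g : ℂ[X]) (W : MultiMat (tensorIndex ι ι))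
    (hW : W = diagBloom l p q r * diagBloom l p q r
      ∨ W = star (diagBloom l p q r) * diagBloom l p q r) :
    trace (diagBloom l p q r * aeval W g) = ∑ x, ∑ i, (Polynomial.X * g.comp (Polynomial.X ^ 2)).eval (l x i : ℂ) := by
  rw [trace_tensorIndex_eq_sum_diagonal _ fun x x' h => by simp [diagBloom_apply_of_ne l p q r h]]
  refine Finset.sum_congr rfl fun x _ => ?_
  rw [Pi.mul_apply, aeval_apply, diagBloom_apply]
  refine trace_swap_diagonal_mul_aeval _ g _ ?_ (l x) fun i => ?_
  · have hsw (a c : ι x × ι x) : c = a.swap ↔ a = c.swap := by grind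
    refine hW.imp (fun h => ?_) fun h => ?_
    · ext a b
      rw [h, Pi.mul_apply, diagBloom_apply, mul_apply, Finset.sum_eq_single a.swap]
      · simp only [of_apply, if_true, Prod.swap_swap, diagonal_apply]
        by_cases hab : b = a
        · subst hab
          simp [mul_comm]
        · simp [hab, Ne.symm hab]
      · intro c _ hc
        simp [hc]
      · simp
    · ext a b
      rw [h, Pi.mul_apply, Pi.star_apply, diagBloom_apply, mul_apply,
        Finset.sum_eq_single a.swap]
      · simp only [of_apply, star_apply, if_true, Prod.swap_swap, diagonal_apply]
        by_cases hab : b = a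
        · subst hab
          simp
        · simp [hab, Ne.symm hab]
      · intro c _ hc
        simp [star_apply, (hsw c a).not.mpr hc]
      · simp
  · simp only [rpow_mul_rpow_one_sub (hl x i)]
    congr 1
    ring

theorem trace_aeval_bloc (A : MultiMat ι) (g : ℂ[X]) :
    (aeval (bloc A) g).trace = ∑ x, (aeval (A x) g).trace := by
  have h := aeval_algHom_apply (AlgHom.mk' (blockDiagonal'RingHom ι ℂ)
    fun (c : ℂ) A => blockDiagonal'_smul c A) A g
  have h' : aeval (bloc A) g = blockDiagonal' (aeval A g) := h
  rw [h', trace_blockDiagonal']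
  simp [aeval_apply]

end MultiMat

end

/-! ### Transport to a general process. -/

namespace QuantumProcess

open MultiMat Matrix Polynomial Unitary

variable {X : Type u} {Y : Type v} [Fintype X] [DecidableEq X] [Fintype Y] [DecidableEq Y]
  {m : X → ℕ} {n : Y → ℕ}

/-- For a channel that is a `*`-isomorphism, a member of the `(p,q,r)`-family is the image of the
bloom of the diagonalized state under `id ⊗ E` and a change of basis. -/
theorem pqrBloom_eq (P : QuantumProcess m n)
    (e : (MultiMat fun x => Fin (m x)) →⋆ₐ[ℂ] (MultiMat fun y => Fin (n y)))
    (he : P.channel = e.toAlgHom.toLinearMap) (p q r : ℝ) :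
    pqrBloom p q r P = idTensorStarAlgHom (fun x => Fin (m x)) e
      (conjStarAlgAut ℂ _ (unitaryTmul (eigenvectorUnitary P.state fun x =>
          (P.isState.1 x).isHermitian))
        (diagBloom (fun x => (P.isState.1 x).isHermitian.eigenvalues) p q r)) := by
  have h (A : MultiMat fun x => Fin (m x)) :
      idTensorStarAlgHom (fun x => Fin (m x)) e (A.tmul 1) = A.tmul 1 := by
    refine (idTensor_tmul e.toAlgHom.toLinearMap A 1).trans (congrArg _ ?_)
    exact map_one e
  have hJ : channelState P.channel
      = idTensorStarAlgHom (fun x => Fin (m x)) e (hsAdjoint (mulMap _) 1) := by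
    rw [he]
    rfl
  refine Eq.trans ?_ (congrArg (idTensorStarAlgHom (fun x => Fin (m x)) e)
    (conjStarAlgAut_diagBloom P.state (fun x => (P.isState.1 x).isHermitian) p q r)).symm
  rw [map_add, map_smul, map_smul, map_mul, map_mul, map_mul, map_mul, h, h, h, h, ← hJ]
  rfl

/-- Any `*`-polynomial of the indicated form in a member of the `(p,q,r)`-family has the same trace
as the corresponding odd polynomial in the initial state. -/
theorem trace_pqrBloom_mul_aeval (P : QuantumProcess m n)
    (e : (MultiMat fun x => Fin (m x)) →⋆ₐ[ℂ] (MultiMat fun y => Fin (n y)))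
    (he : P.channel = e.toAlgHom.toLinearMap) (p q r : ℝ) (g : ℂ[X])
    (W : MultiMat (tensorIndex (fun x => Fin (m x)) fun y => Fin (n y)))
    (hW : W = pqrBloom p q r P * pqrBloom p q r P
      ∨ W = star (pqrBloom p q r P) * pqrBloom p q r P) :
    (pqrBloom p q r P * aeval W g).trace
      = (aeval (bloc P.state) (Polynomial.X * g.comp (Polynomial.X ^ 2))).trace := by
  set l := fun x => (P.isState.1 x).isHermitian.eigenvalues with hl
  set U := unitaryTmul (eigenvectorUnitary P.state fun x => (P.isState.1 x).isHermitian)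
  have hψ := P.pqrBloom_eq e he p q r
  set Φ := idTensorStarAlgHom (fun x => Fin (m x)) e with hΦ
  have htr (T) : (Φ (conjStarAlgAut ℂ _ U T)).trace = T.trace := by
    rw [← trace_conjStarAlgAut U T]
    exact trace_idTensor (he ▸ P.tracePreserving) _
  obtain ⟨W', hW', hWW'⟩ : ∃ W', W = Φ (conjStarAlgAut ℂ _ U W') ∧
      (W' = diagBloom l p q r * diagBloom l p q r
        ∨ W' = star (diagBloom l p q r) * diagBloom l p q r) := by
    rcases hW with h | h
    · exact ⟨_, by rw [h, hψ, map_mul, map_mul], Or.inl rfl⟩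
    · exact ⟨_, by rw [h, hψ, map_mul, map_mul, map_star, map_star], Or.inr rfl⟩
  rw [hW', hψ, aeval_algHom_apply Φ, aeval_algHom_apply (conjStarAlgAut ℂ _ U), ← map_mul,
    ← map_mul, htr, trace_diagBloom_mul_aeval l (fun x i => (P.isState.1 x).eigenvalues_nonneg i)
      p q r g W' hWW', trace_aeval_bloc]
  refine Finset.sum_congr rfl fun x _ => ?_
  rw [trace_aeval_eq_sum_roots_charpoly,
    (P.isState.1 x).isHermitian.roots_charpoly_eq_eigenvalues, Multiset.map_map]
  rfl

end QuantumProcess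

/-! ### Interpolation of the logarithm and the entropy formula. -/

theorem Polynomial.exists_eval_eq_on_finset {K : Type*} [Field K] [DecidableEq K] (s : Finset K)
    (f : K → K) : ∃ g : Polynomial K, ∀ z ∈ s, g.eval z = f z :=
  ⟨Lagrange.interpolate s id f, fun _ hz =>
    Lagrange.eval_interpolate_at_node f (Set.injOn_id _) hz⟩

theorem corollary5p5 (ψ : ProcessFunction.{u, v}) (hψ : ψ ∈ pqrFamily)
    {X : Type u} {Y : Type v} [Fintype X] [DecidableEq X] [Fintype Y] [DecidableEq Y]
    (m : X → ℕ) (n : Y → ℕ) (P : QuantumProcess m n)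
    (hE : ∃ e : (MultiMat fun x => Fin (m x)) ≃⋆ₐ[ℂ] (MultiMat fun y => Fin (n y)),
      ∀ A, P.channel A = e A) :
    -(ψ P * (ψ P).abs.log).trace = (P.state.entropy P.isState : ℂ) ∧
    -((ψ P).mspec.map fun z : ℂ => z * (Real.log ‖z‖ : ℂ)).sum
      = (P.state.entropy P.isState : ℂ) := by
  classical
  obtain ⟨p, -, q, -, r, -, rfl⟩ := hψ
  obtain ⟨e, he⟩ := hE
  set T := pqrBloom p q r P with hT
  have hpos (z : X × Y) : (star (T z) * T z).PosSemidef := Matrix.posSemidef_conjTranspose_mul_self _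
  have hρ := P.isState.bloc_isHermitian
  -- The nodes are the eigenvalues of the blocks of `T†T`, the squares of those of `T`, and the
  -- squares of those of `ρ`. The factor `1/2` undoes the squaring, and `Real.log 0 = 0` encodes the
  -- convention on the kernel.
  obtain ⟨g, hg⟩ := Polynomial.exists_eval_eq_on_finset
    ((Finset.univ.biUnion fun z => Finset.univ.image fun i => ((hpos z).isHermitian.eigenvalues i : ℂ))
      ∪ (T.mspec.toFinset.image fun z => z ^ 2)
      ∪ Finset.univ.image fun i => (hρ.eigenvalues i : ℂ) ^ 2)
    fun w => (Real.log ‖w‖ / 2 : ℝ)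
  have hodd (z : ℂ) (hz : g.eval (z ^ 2) = (Real.log ‖z ^ 2‖ / 2 : ℝ)) :
      (Polynomial.X * g.comp (Polynomial.X ^ 2)).eval z = z * (Real.log ‖z‖ : ℂ) := by
    simp [hz, norm_pow, Real.log_pow]
  have htr := P.trace_pqrBloom_mul_aeval (e : (MultiMat fun x => Fin (m x)) →⋆ₐ[ℂ] (MultiMat fun y => Fin (n y)))
    (LinearMap.ext he) p q r g
  have hS : (P.state.entropy P.isState : ℂ) = -(Polynomial.aeval P.state.bloc
      (Polynomial.X * g.comp (Polynomial.X ^ 2))).trace := by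
    rw [Matrix.trace_aeval_eq_sum_roots_charpoly, hρ.roots_charpoly_eq_eigenvalues,
      Multiset.map_map, MultiMat.entropy, matrixEntropy, Complex.ofReal_neg, Complex.ofReal_sum]
    refine congrArg Neg.neg (Finset.sum_congr rfl fun i _ => ?_)
    refine Eq.trans ?_ (hodd _ (hg _ ?_)).symm
    · simp
    · simp
  refine ⟨?_, ?_⟩
  · rw [hS, ← htr _ (Or.inr rfl)]
    congr 4
    funext z
    rw [MultiMat.aeval_apply]
    -- On the nonnegative spectrum of `T†T`, including `0`, `log ∘ sqrt` is half the logarithm,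
    -- hence equals `g`.
    refine (hpos z).isHermitian.cfc_log_cfc_sqrt.trans
      ((hpos z).isHermitian.cfc_eq_aeval _ _ fun i => ?_)
    rw [hg _ (by
      simp only [Finset.mem_union, Finset.mem_biUnion, Finset.mem_image]
      exact Or.inl (Or.inl ⟨z, Finset.mem_univ _, i, Finset.mem_univ _, rfl⟩))]
    simp [Real.log_sqrt ((hpos z).eigenvalues_nonneg i)]
  · rw [hS, ← htr _ (Or.inl rfl), ← hT]
    have h1 : T.mspec.map (fun z : ℂ => z * (Real.log ‖z‖ : ℂ))
        = T.mspec.map fun z => (Polynomial.X * g.comp (Polynomial.X ^ 2)).eval z := by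
      refine Multiset.map_congr rfl fun z hz => (hodd z (hg _ ?_)).symm
      simp only [Finset.mem_union, Finset.mem_image]
      exact Or.inl (Or.inr ⟨z, Multiset.mem_toFinset.mpr hz, rfl⟩)
    rw [h1, MultiMat.mspec, ← Multiset.coe_mapAddMonoidHom, map_sum, Multiset.sum_sum]
    refine congrArg Neg.neg (Finset.sum_congr rfl fun z _ => ?_)
    rw [Multiset.coe_mapAddMonoidHom, ← Matrix.trace_aeval_eq_sum_roots_charpoly, Pi.mul_apply,
      MultiMat.aeval_apply]
    simp [Polynomial.aeval_comp, sq]
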